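/- Let $s>0$, let $E_k$ $(k\ge 1)$ be (relatively) open subsets of $[0,1]$, and let $\mu_k$ be Borel probability measures carried by $E_k$, that is $\mu_k(E_k)=1$ (so that the support of $\mu_k$ lies in $\overline{E_k}$ and $\mu_k(\overline{E_k}\setminus E_k)=0$), that converge weakly to a measure $\mu$ on $[0,1]$ with density $h\in L^2([0,1])$. Assume that $\mu(I)>0$ for all intervals $I\subset[0,1]$ with non-empty interior, and that for each $\varepsilon>0$ there is a constant $C_\varepsilon$ such that $$|I|^{1+\varepsilon}\,\lVert h\chi_I\rVert_2^2\le C_\varepsilon\,\lVert h\chi_I\rVert_1^2$$ holds for every interval $I\subset[0,1]$, where $|I|$ is the length of $I$ and $\chi_I$ its indicator function. If there is a constant $C$ such that $$\iint |x-y|^{-s}\,\mathrm d\mu_k(x)\,\mathrm d\mu_k(y)\le C$$ holds for all $k$, then $\limsup_{k\to\infty} E_k=\bigcap_{m}\bigcup_{k\ge m}E_k$ belongs to the class $\mathscr G^s([0,1])$. Here $\mathscr G^s([0,1])$ is the class of $G_\delta$ subsets $E$ of $[0,1]$ such that for each $t$ with $0<t<s$ there is a constant $c>0$ such that $\mathscr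 M^t_\infty(E\cap D)\ge c\,\mathscr M^t_\infty(D)$ for all dyadic intervals $D\subset[0,1]$. A dyadic interval is one of the form $[j2^{-n},(j+1)2^{-n})$ with $n,j\in\mathbb Z$, and $\mathscr M^t_\infty(A)=\inf\{\sum_i|D_i|^t : A\subset\bigcup_i D_i\}$, where the infimum is over all countable covers of $A$ by dyadic intervals $D_i$. -/

import Mathlib

open MeasureTheory Set Filter Topology
open scoped ENNReal NNReal

/-- The half-open dyadic interval `[j 2^{-n}, (j+1) 2^{-n})`, of length `2^{-n}`, for `n j : ℤ`. -/
def dyadicInterval (n j : ℤ) : Set ℝ :=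
  Ico ((j : ℝ) * (2 : ℝ) ^ (-n)) (((j : ℝ) + 1) * (2 : ℝ) ^ (-n))

/-- The set function `M_∞^t(A) = inf { ∑ |D_i|^t : A ⊆ ⋃ D_i }`, the infimum being over all (finite
or countable) families of dyadic intervals `D_i` that cover `A`. A family of dyadic intervals is
given by the set `S` of its indices `(n, j)`. -/
noncomputable def dyadicContent (t : ℝ) (A : Set ℝ) : ℝ≥0∞ :=
  ⨅ (S : Set (ℤ × ℤ)) (_ : A ⊆ ⋃ p ∈ S, dyadicInterval p.1 p.2),
    ∑' p : S, ENNReal.ofReal (((2 : ℝ) ^ (-(p : ℤ × ℤ).1)) ^ t)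

/-- The class `𝒢^s([0,1])`: the `G_δ` subsets `A` of `[0,1]` such that for each `t < s` there is
a constant `c > 0` with `M_∞^t(A ∩ D) ≥ c M_∞^t(D)` for all dyadic intervals `D ⊆ [0,1]`. -/
def LargeIntersectionClass (s : ℝ) : Set (Set ℝ) :=
  {A | A ⊆ Icc 0 1 ∧ IsGδ A ∧
    ∀ t : ℝ, 0 < t → t < s → ∃ c : ℝ≥0, 0 < c ∧
      ∀ n j : ℤ, dyadicInterval n j ⊆ Icc 0 1 →
        (c : ℝ≥0∞) * dyadicContent t (dyadicInterval n j) ≤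
          dyadicContent t (A ∩ dyadicInterval n j)}

/-- The `s`-energy `∬ |x - y|^{-s} dν(x) dν(y)`, with values in `[0,∞]`. For `s > 0` the kernel is
`∞` on the diagonal. -/
noncomputable def rieszEnergy (s : ℝ) (ν : Measure ℝ) : ℝ≥0∞ :=
  ∫⁻ y, ∫⁻ x, ENNReal.ofReal |x - y| ^ (-s) ∂ν ∂ν

/-! ### Dyadic intervals: lengths and nesting -/

/-- The length `2^{-n}` of the dyadic intervals of level `n`. -/
noncomputable def dyadicLength (n : ℤ) : ℝ≥0∞ := (2 : ℝ≥0∞) ^ (-(n : ℝ))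

theorem ofReal_two_zpow_neg (n : ℤ) : ENNReal.ofReal ((2 : ℝ) ^ (-n)) = dyadicLength n := by
  rw [dyadicLength, ← Real.rpow_intCast, ← ENNReal.ofReal_rpow_of_pos two_pos]
  simp

theorem volume_dyadicInterval (n j : ℤ) : volume (dyadicInterval n j) = dyadicLength n := by
  rw [dyadicInterval, Real.volume_Ico, ← ofReal_two_zpow_neg]
  congr 1; ring

theorem dyadicLength_ne_zero (n : ℤ) : dyadicLength n ≠ 0 := by
  simp [dyadicLength, ENNReal.rpow_eq_zero_iff]

theorem dyadicLength_ne_top (n : ℤ) : dyadicLength n ≠ ∞ := by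
  simp [dyadicLength, ENNReal.rpow_eq_top_iff]

theorem dyadicLength_rpow (n : ℤ) (t : ℝ) : dyadicLength n ^ t = (2 : ℝ≥0∞) ^ (-(n : ℝ) * t) := by
  rw [dyadicLength, ← ENNReal.rpow_mul]

theorem dyadicLength_rpow_ne_zero (n : ℤ) (t : ℝ) : dyadicLength n ^ t ≠ 0 := by
  simp [dyadicLength_rpow, ENNReal.rpow_eq_zero_iff]

theorem dyadicLength_rpow_ne_top (n : ℤ) (t : ℝ) : dyadicLength n ^ t ≠ ∞ := by
  simp [dyadicLength_rpow, ENNReal.rpow_eq_top_iff]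

theorem dyadicLength_le_iff {m n : ℤ} : dyadicLength m ≤ dyadicLength n ↔ n ≤ m := by
  rw [← ofReal_two_zpow_neg, ← ofReal_two_zpow_neg, ENNReal.ofReal_le_ofReal_iff (by positivity),
    zpow_le_zpow_iff_right₀ one_lt_two, neg_le_neg_iff]

theorem measurableSet_dyadicInterval (n j : ℤ) : MeasurableSet (dyadicInterval n j) :=
  measurableSet_Ico

theorem two_zpow_neg_pos (n : ℤ) : (0 : ℝ) < 2 ^ (-n) := by positivity

theorem left_mem_dyadicInterval (n j : ℤ) : (j : ℝ) * 2 ^ (-n) ∈ dyadicInterval n j := by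
  have := two_zpow_neg_pos n
  exact ⟨le_rfl, by nlinarith⟩

theorem nonempty_dyadicInterval (n j : ℤ) : (dyadicInterval n j).Nonempty :=
  ⟨_, left_mem_dyadicInterval n j⟩

theorem mem_dyadicInterval_floor (n : ℤ) (x : ℝ) : x ∈ dyadicInterval n ⌊x * 2 ^ n⌋ := by
  have h2 : (0 : ℝ) < 2 ^ n := by positivity
  rw [dyadicInterval, zpow_neg, ← div_eq_mul_inv, ← div_eq_mul_inv]
  exact ⟨(div_le_iff₀ h2).2 (Int.floor_le _), (lt_div_iff₀ h2).2 (Int.lt_floor_add_one _)⟩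

theorem eq_floor_of_mem_dyadicInterval {n j : ℤ} {x : ℝ} (hx : x ∈ dyadicInterval n j) :
    ⌊x * 2 ^ n⌋ = j := by
  have h2 : (0 : ℝ) < 2 ^ n := by positivity
  rw [dyadicInterval, zpow_neg, ← div_eq_mul_inv, ← div_eq_mul_inv] at hx
  exact Int.floor_eq_iff.2 ⟨(div_le_iff₀ h2).1 hx.1, (lt_div_iff₀ h2).1 hx.2⟩

theorem dyadicInterval_index_unique {n i j : ℤ} {x : ℝ} (hi : x ∈ dyadicInterval n i)
    (hj : x ∈ dyadicInterval n j) : i = j :=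
  (eq_floor_of_mem_dyadicInterval hi).symm.trans (eq_floor_of_mem_dyadicInterval hj)

theorem pairwise_disjoint_dyadicInterval (n : ℤ) :
    Pairwise (Function.onFun Disjoint (dyadicInterval n)) := fun _ _ hij =>
  Set.disjoint_left.2 fun _ hi hj => hij (dyadicInterval_index_unique hi hj)

theorem abs_sub_le_of_mem_dyadicInterval {n j : ℤ} {x y : ℝ} (hx : x ∈ dyadicInterval n j)
    (hy : y ∈ dyadicInterval n j) : |x - y| ≤ 2 ^ (-n) := by
  obtain ⟨h1, h2⟩ := hx
  obtain ⟨h3, h4⟩ := hy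
  rw [abs_le]; constructor <;> linarith

theorem two_zpow_neg_add_nat (n : ℤ) (i : ℕ) : (2 : ℝ) ^ (-n) = 2 ^ i * 2 ^ (-(n + i)) := by
  rw [← zpow_natCast, ← zpow_add₀ two_ne_zero]; congr 1; ring

theorem dyadicInterval_subset_iff (n j : ℤ) (i : ℕ) (k : ℤ) :
    dyadicInterval (n + i) k ⊆ dyadicInterval n j ↔ k ∈ Finset.Ico (j * 2 ^ i) ((j + 1) * 2 ^ i) := by
  have h2 := two_zpow_neg_pos (n + i)
  rw [dyadicInterval, dyadicInterval, Ico_subset_Ico_iff (by nlinarith), Finset.mem_Ico,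
    two_zpow_neg_add_nat n i, ← mul_assoc, ← mul_assoc, mul_le_mul_iff_left₀ h2,
    mul_le_mul_iff_left₀ h2, ← Int.add_one_le_iff]
  exact and_congr (by exact_mod_cast Iff.rfl) (by exact_mod_cast Iff.rfl)

theorem dyadicInterval_subset_of_mem {m n a b : ℤ} (hmn : m ≤ n) {x : ℝ}
    (hm : x ∈ dyadicInterval m a) (hn : x ∈ dyadicInterval n b) :
    dyadicInterval n b ⊆ dyadicInterval m a := by
  obtain ⟨i, rfl⟩ := Int.le.dest hmn
  rw [dyadicInterval_subset_iff, Finset.mem_Ico]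
  have h2 := two_zpow_neg_pos (m + i)
  obtain ⟨h3, h4⟩ := hm
  obtain ⟨h5, h6⟩ := hn
  rw [two_zpow_neg_add_nat m i, ← mul_assoc] at h3 h4
  have h7 := (mul_lt_mul_iff_left₀ h2).1 (h3.trans_lt h6)
  have h8 := (mul_lt_mul_iff_left₀ h2).1 (h5.trans_lt h4)
  constructor
  · rw [← Int.lt_add_one_iff]; exact_mod_cast h7
  · exact_mod_cast h8

theorem level_le_of_dyadicInterval_subset {m n a b : ℤ}
    (h : dyadicInterval n b ⊆ dyadicInterval m a) : m ≤ n := by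
  rw [← dyadicLength_le_iff, ← volume_dyadicInterval n b, ← volume_dyadicInterval m a]
  exact measure_mono h

theorem dyadicInterval_nested {m n a b : ℤ} {x : ℝ}
    (hm : x ∈ dyadicInterval m a) (hn : x ∈ dyadicInterval n b) :
    dyadicInterval n b ⊆ dyadicInterval m a ∨ dyadicInterval m a ⊆ dyadicInterval n b :=
  (le_total m n).imp (dyadicInterval_subset_of_mem · hm hn) (dyadicInterval_subset_of_mem · hn hm)

/-! ### Dyadic content -/

/-- The measure on indices of dyadic intervals with mass `|D|^t` at the index of `D`. -/
noncomputable def dyadicCost (t : ℝ) : Measure (ℤ × ℤ) :=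
  Measure.sum fun p => dyadicLength p.1 ^ t • Measure.dirac p

theorem dyadicCost_apply (t : ℝ) (S : Set (ℤ × ℤ)) :
    dyadicCost t S = ∑' p : S, dyadicLength (p : ℤ × ℤ).1 ^ t := by
  rw [dyadicCost, Measure.sum_apply _ (MeasurableSet.of_discrete),
    tsum_subtype S fun p => dyadicLength p.1 ^ t]
  refine tsum_congr fun p => ?_
  rw [Measure.smul_apply, Measure.dirac_apply]
  by_cases hp : p ∈ S <;> simp [hp]

theorem dyadicCost_singleton (t : ℝ) (p : ℤ × ℤ) : dyadicCost t {p} = dyadicLength p.1 ^ t := by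
  rw [dyadicCost_apply, tsum_singleton p fun p => dyadicLength p.1 ^ t]

theorem dyadicLength_rpow_le_dyadicCost {t : ℝ} {S : Set (ℤ × ℤ)} {p : ℤ × ℤ} (hp : p ∈ S) :
    dyadicLength p.1 ^ t ≤ dyadicCost t S := by
  rw [← dyadicCost_singleton]; exact measure_mono (singleton_subset_iff.2 hp)

theorem dyadicContent_eq (t : ℝ) (A : Set ℝ) : dyadicContent t A =
    ⨅ (S : Set (ℤ × ℤ)) (_ : A ⊆ ⋃ p ∈ S, dyadicInterval p.1 p.2), dyadicCost t S := by
  simp only [dyadicContent, dyadicCost_apply, ← ofReal_two_zpow_neg]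
  refine iInf_congr fun S => iInf_congr fun _ => tsum_congr fun p => ?_
  rw [ENNReal.ofReal_rpow_of_pos (by positivity)]

theorem dyadicContent_le_dyadicCost {t : ℝ} {A : Set ℝ} {S : Set (ℤ × ℤ)}
    (h : A ⊆ ⋃ p ∈ S, dyadicInterval p.1 p.2) : dyadicContent t A ≤ dyadicCost t S := by
  rw [dyadicContent_eq]; exact iInf₂_le S h

theorem le_dyadicContent {t : ℝ} {A : Set ℝ} {b : ℝ≥0∞}
    (h : ∀ S : Set (ℤ × ℤ), A ⊆ ⋃ p ∈ S, dyadicInterval p.1 p.2 → b ≤ dyadicCost t S) :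
    b ≤ dyadicContent t A := by
  rw [dyadicContent_eq]; exact le_iInf₂ h

theorem exists_dyadicCost_lt {t : ℝ} {A : Set ℝ} {b : ℝ≥0∞} (h : dyadicContent t A < b) :
    ∃ S : Set (ℤ × ℤ), A ⊆ ⋃ p ∈ S, dyadicInterval p.1 p.2 ∧ dyadicCost t S < b := by
  rw [dyadicContent_eq] at h; simpa only [iInf_lt_iff, exists_prop] using h

theorem dyadicContent_mono {t : ℝ} {A B : Set ℝ} (h : A ⊆ B) :
    dyadicContent t A ≤ dyadicContent t B :=
  le_dyadicContent fun _ hS => dyadicContent_le_dyadicCost (h.trans hS)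

theorem dyadicContent_dyadicInterval_le (t : ℝ) (n j : ℤ) :
    dyadicContent t (dyadicInterval n j) ≤ dyadicLength n ^ t := by
  rw [← dyadicCost_singleton t (n, j)]
  exact dyadicContent_le_dyadicCost (by simp)

theorem volume_biUnion_dyadicInterval_le (S : Set (ℤ × ℤ)) :
    volume (⋃ p ∈ S, dyadicInterval p.1 p.2) ≤ ∑' p : S, dyadicLength (p : ℤ × ℤ).1 := by
  rw [biUnion_eq_iUnion]
  refine (measure_iUnion_le _).trans_eq (tsum_congr fun p => ?_)
  exact volume_dyadicInterval _ _

/-- Every member `Q` of so cheap a family is no longer than the level-`n` interval `D`, so `|Q| ≤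
|D|^(1-t) |Q|^t` because `t ≤ 1`; then sum. -/
theorem volume_biUnion_dyadicInterval_lt {t : ℝ} (ht0 : 0 < t) (ht1 : t ≤ 1) {n : ℤ}
    {S : Set (ℤ × ℤ)} (hS : dyadicCost t S < dyadicLength n ^ t) :
    volume (⋃ p ∈ S, dyadicInterval p.1 p.2) < dyadicLength n := by
  have key : ∀ p : S, dyadicLength (p : ℤ × ℤ).1 ≤
      dyadicLength n ^ (1 - t) * dyadicLength (p : ℤ × ℤ).1 ^ t := by
    intro p
    have h1 : dyadicLength (p : ℤ × ℤ).1 ≤ dyadicLength n :=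
      (ENNReal.rpow_le_rpow_iff ht0).1
        ((dyadicLength_rpow_le_dyadicCost p.2).trans hS.le)
    calc dyadicLength (p : ℤ × ℤ).1
        = dyadicLength (p : ℤ × ℤ).1 ^ (1 - t) * dyadicLength (p : ℤ × ℤ).1 ^ t := by
          rw [← ENNReal.rpow_add _ _ (dyadicLength_ne_zero _) (dyadicLength_ne_top _)]; simp
      _ ≤ _ := by gcongr
  calc volume (⋃ p ∈ S, dyadicInterval p.1 p.2)
      ≤ ∑' p : S, dyadicLength (p : ℤ × ℤ).1 := volume_biUnion_dyadicInterval_le S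
    _ ≤ ∑' p : S, dyadicLength n ^ (1 - t) * dyadicLength (p : ℤ × ℤ).1 ^ t :=
        ENNReal.tsum_le_tsum key
    _ = dyadicLength n ^ (1 - t) * dyadicCost t S := by rw [ENNReal.tsum_mul_left, dyadicCost_apply]
    _ < dyadicLength n ^ (1 - t) * dyadicLength n ^ t :=
        (ENNReal.mul_lt_mul_iff_right (dyadicLength_rpow_ne_zero _ _)
          (dyadicLength_rpow_ne_top _ _)).2 hS
    _ = dyadicLength n := by
        rw [← ENNReal.rpow_add _ _ (dyadicLength_ne_zero _) (dyadicLength_ne_top _)]; simp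

theorem dyadicContent_dyadicInterval {t : ℝ} (ht0 : 0 < t) (ht1 : t ≤ 1) (n j : ℤ) :
    dyadicContent t (dyadicInterval n j) = dyadicLength n ^ t := by
  refine (dyadicContent_dyadicInterval_le t n j).antisymm (le_dyadicContent fun S hS => ?_)
  by_contra! hlt
  refine (volume_biUnion_dyadicInterval_lt ht0 ht1 hlt).not_ge ?_
  rw [← volume_dyadicInterval n j]
  exact measure_mono hS

theorem exists_mem_dyadicInterval (n : ℤ) (x : ℝ) : ∃ j, x ∈ dyadicInterval n j :=
  ⟨_, mem_dyadicInterval_floor n x⟩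

theorem dyadicLength_add_nat (n : ℤ) (i : ℕ) :
    dyadicLength (n + i) = dyadicLength n * (2 : ℝ≥0∞) ^ (-(i : ℝ)) := by
  rw [dyadicLength, dyadicLength, ← ENNReal.rpow_add _ _ (by simp) (by simp)]
  push_cast; congr 1; ring

theorem tendsto_dyadicLength_add_rpow (n : ℤ) {u : ℝ} (hu : 0 < u) :
    Tendsto (fun i : ℕ => dyadicLength (n + i) ^ u) atTop (𝓝 0) := by
  have h1 : ∀ i : ℕ, dyadicLength (n + i) ^ u =
      dyadicLength n ^ u * ((2 : ℝ≥0∞) ^ (-u)) ^ i := by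
    intro i
    rw [dyadicLength_add_nat, ENNReal.mul_rpow_of_nonneg _ _ hu.le, ← ENNReal.rpow_mul,
      ← ENNReal.rpow_natCast, ← ENNReal.rpow_mul]
    congr 2; ring
  simp_rw [h1]
  have h2 : (2 : ℝ≥0∞) ^ (-u) < 1 := ENNReal.rpow_lt_one_of_one_lt_of_neg (by simp) (by linarith)
  simpa using ENNReal.Tendsto.const_mul (ENNReal.tendsto_pow_atTop_nhds_zero_of_lt_one h2)
    (Or.inr (dyadicLength_rpow_ne_top n u))

/-! ### From a weaker exponent to full content -/

/-- The members of `S` inside a dyadic interval not covered by any single member still cover. -/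
theorem subset_biUnion_sep {S : Set (ℤ × ℤ)} {A : Set ℝ} {n j : ℤ}
    (hcov : A ∩ dyadicInterval n j ⊆ ⋃ p ∈ S, dyadicInterval p.1 p.2)
    (hnot : ∀ p ∈ S, ¬ dyadicInterval n j ⊆ dyadicInterval p.1 p.2) :
    A ∩ dyadicInterval n j ⊆
      ⋃ p ∈ {p ∈ S | dyadicInterval p.1 p.2 ⊆ dyadicInterval n j}, dyadicInterval p.1 p.2 := by
  intro x hx
  obtain ⟨p, hp, hxp⟩ := mem_iUnion₂.1 (hcov hx)
  refine mem_iUnion₂.2 ⟨p, ⟨hp, ?_⟩, hxp⟩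
  exact (dyadicInterval_nested hx.2 hxp).resolve_right (hnot p hp)

/-- A lower bound for the content of `A` in all dyadic subintervals of `D` with some exponent
`u < 1` improves to the full content in `D`. -/
theorem dyadicLength_rpow_le_dyadicContent_inter {t u : ℝ} (ht0 : 0 < t) (ht1 : t ≤ 1)
    (hu1 : u < 1) {c : ℝ≥0∞} (hc : c ≠ 0) {A : Set ℝ} {n j : ℤ}
    (hA : ∀ m k, dyadicInterval m k ⊆ dyadicInterval n j →
      c * dyadicLength m ^ u ≤ dyadicContent t (A ∩ dyadicInterval m k)) :
    dyadicLength n ^ t ≤ dyadicContent t (A ∩ dyadicInterval n j) := by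
  classical
  refine le_dyadicContent fun S hS => ?_
  by_contra! hlt
  set T := dyadicInterval n j \ ⋃ p ∈ S, dyadicInterval p.1 p.2 with hT
  have hTpos : volume T ≠ 0 := by
    intro h0
    refine (volume_biUnion_dyadicInterval_lt ht0 ht1 hlt).not_ge ?_
    rw [← volume_dyadicInterval n j]
    exact measure_mono_ae (ae_le_set.2 h0)
  -- At scale `δ`, at least `|T|/δ` subintervals meet the uncovered set `T`, each forcing cost `c
  -- δ^u`. As `u < 1`, letting `δ → 0` contradicts finite cost.
  have key : ∀ i : ℕ, volume T * c ≤ dyadicCost t S * dyadicLength (n + i) ^ (1 - u) := by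
    intro i
    set J := (Finset.Ico (j * 2 ^ i) ((j + 1) * 2 ^ i)).filter
      fun k => (dyadicInterval (n + i) k ∩ T).Nonempty with hJ
    have hTJ : volume T ≤ J.card * dyadicLength (n + i) := by
      have hsub : T ⊆ ⋃ k ∈ J, dyadicInterval (n + i) k := by
        intro x hx
        obtain ⟨k, hk⟩ := exists_mem_dyadicInterval (n + i) x
        refine mem_iUnion₂.2 ⟨k, ?_, hk⟩
        rw [hJ, Finset.mem_filter, ← dyadicInterval_subset_iff]
        exact ⟨dyadicInterval_subset_of_mem (by simp) hx.1 hk, ⟨x, hk, hx⟩⟩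
      refine (measure_mono hsub).trans ((measure_biUnion_finset_le _ _).trans_eq ?_)
      simp [volume_dyadicInterval]
    have hcost : J.card * (c * dyadicLength (n + i) ^ u) ≤ dyadicCost t S := by
      calc J.card * (c * dyadicLength (n + i) ^ u)
          = ∑ k ∈ J, c * dyadicLength (n + i) ^ u := by simp
        _ ≤ ∑ k ∈ J, dyadicCost t
              {p ∈ S | dyadicInterval p.1 p.2 ⊆ dyadicInterval (n + i) k} := by
            refine Finset.sum_le_sum fun k hk => ?_
            rw [hJ, Finset.mem_filter, ← dyadicInterval_subset_iff] at hk
            refine (hA _ _ hk.1).trans (dyadicContent_le_dyadicCost (subset_biUnion_sep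
              ((inter_subset_inter_right A hk.1).trans hS) fun p hp hsub => ?_))
            obtain ⟨x, hx1, hx2⟩ := hk.2
            exact hx2.2 (mem_iUnion₂.2 ⟨p, hp, hsub hx1⟩)
        -- Same-level intervals are disjoint, so no member of `S` is counted for two of them.
        _ = dyadicCost t (⋃ k ∈ J,
              {p ∈ S | dyadicInterval p.1 p.2 ⊆ dyadicInterval (n + i) k}) := by
            refine (measure_biUnion_finset ?_ fun _ _ => MeasurableSet.of_discrete).symm
            intro k _ l _ hkl
            refine Set.disjoint_left.2 fun p hpk hpl => hkl ?_
            obtain ⟨x, hx⟩ := nonempty_dyadicInterval p.1 p.2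
            exact dyadicInterval_index_unique (hpk.2 hx) (hpl.2 hx)
        _ ≤ dyadicCost t S := measure_mono (iUnion₂_subset fun k _ => sep_subset _ _)
    calc volume T * c ≤ J.card * dyadicLength (n + i) * c := by gcongr
      _ = J.card * (c * dyadicLength (n + i) ^ u) * dyadicLength (n + i) ^ (1 - u) := by
          have h1 : dyadicLength (n + i) =
              dyadicLength (n + i) ^ u * dyadicLength (n + i) ^ (1 - u) := by
            rw [← ENNReal.rpow_add _ _ (dyadicLength_ne_zero _) (dyadicLength_ne_top _)]; simp
          nth_rewrite 1 [h1]; ring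
      _ ≤ _ := by gcongr
  have hlim : Tendsto (fun i : ℕ => dyadicCost t S * dyadicLength (n + i) ^ (1 - u)) atTop
      (𝓝 0) := by
    simpa using ENNReal.Tendsto.const_mul (tendsto_dyadicLength_add_rpow n (sub_pos.2 hu1))
      (Or.inr (hlt.trans_le le_top).ne)
  exact mul_ne_zero hTpos hc (le_zero_iff.1 (ge_of_tendsto' hlim key))

/-! ### Continuity of content from below -/

/-- If no member contains `q`, the members inside `q` cover `U` there and so cost at least `|q|^t`;
exchanging them for `q` does not raise the cost. Iterate over `F`. -/
theorem exists_dyadicCost_le_of_finset {t : ℝ} {U : Set ℝ} (F : Finset (ℤ × ℤ))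
    (hF : ∀ q ∈ F, dyadicLength q.1 ^ t ≤ dyadicContent t (U ∩ dyadicInterval q.1 q.2))
    (S : Set (ℤ × ℤ)) (hS : ∀ q ∈ F, U ∩ dyadicInterval q.1 q.2 ⊆
      ⋃ p ∈ S, dyadicInterval p.1 p.2) :
    ∃ S' : Set (ℤ × ℤ), dyadicCost t S' ≤ dyadicCost t S ∧
      (∀ p ∈ S, ∃ p' ∈ S', dyadicInterval p.1 p.2 ⊆ dyadicInterval p'.1 p'.2) ∧
      ∀ q ∈ F, ∃ p' ∈ S', dyadicInterval q.1 q.2 ⊆ dyadicInterval p'.1 p'.2 := by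
  classical
  induction F using Finset.induction_on with
  | empty => exact ⟨S, le_rfl, fun p hp => ⟨p, hp, Subset.rfl⟩, by simp⟩
  | insert q F hq ih =>
    obtain ⟨S₁, hcost, hS₁, hF₁⟩ := ih (fun r hr => hF r (Finset.mem_insert_of_mem hr))
      (fun r hr => hS r (Finset.mem_insert_of_mem hr))
    by_cases hex : ∃ p' ∈ S₁, dyadicInterval q.1 q.2 ⊆ dyadicInterval p'.1 p'.2
    · exact ⟨S₁, hcost, hS₁, fun r hr => (Finset.mem_insert.1 hr).elim (fun h => h ▸ hex) (hF₁ r)⟩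
    push Not at hex
    set R := {p ∈ S₁ | dyadicInterval p.1 p.2 ⊆ dyadicInterval q.1 q.2} with hR
    have hcov : U ∩ dyadicInterval q.1 q.2 ⊆ ⋃ p ∈ S₁, dyadicInterval p.1 p.2 := by
      intro x hx
      obtain ⟨p, hp, hxp⟩ := mem_iUnion₂.1 (hS q (Finset.mem_insert_self _ _) hx)
      obtain ⟨p', hp', hsub⟩ := hS₁ p hp
      exact mem_iUnion₂.2 ⟨p', hp', hsub hxp⟩
    have hqR : dyadicLength q.1 ^ t ≤ dyadicCost t R :=
      (hF q (Finset.mem_insert_self _ _)).trans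
        (dyadicContent_le_dyadicCost (subset_biUnion_sep hcov hex))
    have hlift : ∀ p : ℤ × ℤ,
        (∃ p' ∈ S₁, dyadicInterval p.1 p.2 ⊆ dyadicInterval p'.1 p'.2) →
        ∃ p' ∈ insert q (S₁ \ R), dyadicInterval p.1 p.2 ⊆ dyadicInterval p'.1 p'.2 := by
      rintro p ⟨p', hp', hsub⟩
      by_cases hpR : p' ∈ R
      · exact ⟨q, mem_insert _ _, hsub.trans hpR.2⟩
      · exact ⟨p', mem_insert_of_mem _ ⟨hp', hpR⟩, hsub⟩
    refine ⟨insert q (S₁ \ R), ?_, fun p hp => hlift p (hS₁ p hp), fun r hr => ?_⟩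
    · calc dyadicCost t (insert q (S₁ \ R))
          ≤ dyadicCost t {q} + dyadicCost t (S₁ \ R) := by
            rw [insert_eq]; exact measure_union_le _ _
        _ ≤ dyadicCost t R + dyadicCost t (S₁ \ R) := by
            rw [dyadicCost_singleton]; gcongr
        _ = dyadicCost t S₁ := by
            rw [← measure_union disjoint_sdiff_right MeasurableSet.of_discrete,
              union_sdiff_cancel (sep_subset _ _)]
        _ ≤ dyadicCost t S := hcost
    · rcases Finset.mem_insert.1 hr with rfl | hr
      · exact ⟨r, mem_insert _ _, Subset.rfl⟩
      · exact hlift r (hF₁ r hr)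

theorem exists_level_ge_of_rpow_le {t : ℝ} (ht0 : 0 < t) {v : ℝ≥0∞} (hv : v ≠ ∞) :
    ∃ L : ℤ, ∀ n : ℤ, dyadicLength n ^ t ≤ v → L ≤ n := by
  have h1 : v ^ (1 / t) ≠ ∞ := ENNReal.rpow_ne_top_of_nonneg (by positivity) hv
  obtain ⟨k, hk⟩ := ENNReal.exists_nat_gt h1
  refine ⟨-k, fun n hn => ?_⟩
  rw [← dyadicLength_le_iff]
  have h2 : dyadicLength n ≤ v ^ (1 / t) := by rw [one_div]; exact (ENNReal.le_rpow_inv_iff ht0).2 hn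
  refine h2.trans (hk.le.trans ?_)
  have h3 : dyadicLength (-k : ℤ) = ((2 ^ k : ℕ) : ℝ≥0∞) := by
    simp [dyadicLength]
  rw [h3]
  exact_mod_cast Nat.lt_two_pow_self.le

theorem finite_setOf_dyadicInterval_superset (L : ℤ) (q : ℤ × ℤ) :
    {p : ℤ × ℤ | L ≤ p.1 ∧ dyadicInterval q.1 q.2 ⊆ dyadicInterval p.1 p.2}.Finite := by
  refine Set.Finite.of_finite_image (f := Prod.fst) ((Set.finite_Icc L q.1).subset ?_) ?_
  · rintro _ ⟨p, hp, rfl⟩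
    exact ⟨hp.1, level_le_of_dyadicInterval_subset hp.2⟩
  · rintro ⟨m, a⟩ hp ⟨m', b⟩ hp' h
    obtain rfl : m = m' := h
    obtain ⟨x, hx⟩ := nonempty_dyadicInterval q.1 q.2
    exact Prod.ext rfl (dyadicInterval_index_unique (hp.2 hx) (hp'.2 hx))

theorem dyadicCost_le_of_finset {t : ℝ} {S : Set (ℤ × ℤ)} {v : ℝ≥0∞}
    (h : ∀ H : Finset (ℤ × ℤ), ↑H ⊆ S → dyadicCost t H ≤ v) : dyadicCost t S ≤ v := by
  classical
  rw [dyadicCost_apply]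
  refine ENNReal.summable.tsum_le_of_sum_le fun H => ?_
  have h2 := h (H.image Subtype.val) (by
    intro x hx
    simp only [Finset.coe_image, mem_image] at hx
    obtain ⟨y, -, rfl⟩ := hx; exact y.2)
  rw [dyadicCost_apply] at h2
  rw [Finset.tsum_subtype' (H.image Subtype.val) fun p : ℤ × ℤ => dyadicLength p.1 ^ t,
    Finset.sum_image (fun _ _ _ _ h => Subtype.ext h)] at h2
  exact h2

/-- Continuity from below of the content on unions of dyadic intervals. -/
theorem dyadicContent_biUnion_le_of_finset {t : ℝ} (ht0 : 0 < t) (ht1 : t ≤ 1) {P : Set (ℤ × ℤ)}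
    {v : ℝ≥0∞} (h : ∀ F : Finset (ℤ × ℤ), ↑F ⊆ P →
      dyadicContent t (⋃ p ∈ F, dyadicInterval p.1 p.2) ≤ v) :
    dyadicContent t (⋃ p ∈ P, dyadicInterval p.1 p.2) ≤ v := by
  classical
  refine le_of_forall_gt fun w hvw => ?_
  obtain ⟨w', hvw', hww'⟩ := exists_between hvw
  refine lt_of_le_of_lt ?_ hww'
  clear hvw hww' w
  obtain ⟨w, hvw, hww'⟩ := exists_between hvw'
  refine le_trans ?_ hww'.le
  have hex : ∀ F : Finset P, ∃ S : Set (ℤ × ℤ), dyadicCost t S ≤ w ∧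
      ∀ q ∈ F, ∃ p' ∈ S, dyadicInterval (q : ℤ × ℤ).1 (q : ℤ × ℤ).2 ⊆
        dyadicInterval p'.1 p'.2 := by
    intro F
    obtain ⟨S, hS, hcost⟩ := exists_dyadicCost_lt ((h (F.image Subtype.val) (by
      intro x hx
      simp only [Finset.coe_image, mem_image] at hx
      obtain ⟨y, -, rfl⟩ := hx; exact y.2)).trans_lt hvw)
    obtain ⟨S', hS', -, hF⟩ := exists_dyadicCost_le_of_finset (t := t) (U := univ)
      (F.image Subtype.val)
      (fun q _ => by rw [univ_inter, dyadicContent_dyadicInterval ht0 ht1]) S (fun q hq => by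
        rw [univ_inter]
        exact (subset_biUnion_of_mem (u := fun p : ℤ × ℤ => dyadicInterval p.1 p.2) hq).trans hS)
    exact ⟨S', hS'.trans hcost.le, fun q hq => hF q (Finset.mem_image_of_mem _ hq)⟩
  choose S hScost hSmem using hex
  -- The choice is made total, with junk value `0` off `F`, so that it has a limit in `F` for each
  -- fixed `q`.
  have hg : ∀ (F : Finset P) (q : P), ∃ p' : ℤ × ℤ, q ∈ F → p' ∈ S F ∧
      dyadicInterval (q : ℤ × ℤ).1 (q : ℤ × ℤ).2 ⊆ dyadicInterval p'.1 p'.2 := by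
    intro F q
    by_cases hq : q ∈ F
    · obtain ⟨p', h1, h2⟩ := hSmem F q hq
      exact ⟨p', fun _ => ⟨h1, h2⟩⟩
    · exact ⟨0, fun h => absurd h hq⟩
  choose g hg using hg
  obtain ⟨L, hL⟩ := exists_level_ge_of_rpow_le ht0 (hww'.trans_le le_top).ne
  -- The cost bound limits the length of the interval chosen for `q`, leaving finitely many
  -- candidates; along an ultrafilter the choice is eventually constant. The limit intervals form
  -- the cover.
  let 𝒰 : Ultrafilter (Finset P) := Ultrafilter.of atTop
  have hmem : ∀ q : P, ∀ᶠ F in (𝒰 : Filter (Finset P)), q ∈ F := fun q =>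
    Ultrafilter.of_le atTop ((eventually_ge_atTop {q}).mono fun F hF => by
      simpa using hF)
  have hlim : ∀ q : P, ∃ p' : ℤ × ℤ, ∀ᶠ F in (𝒰 : Filter (Finset P)), g F q = p' := by
    intro q
    have hfin := finite_setOf_dyadicInterval_superset L q
    have h1 : ∀ᶠ F in (𝒰 : Filter (Finset P)), g F q ∈ {p : ℤ × ℤ | L ≤ p.1 ∧
        dyadicInterval (q : ℤ × ℤ).1 (q : ℤ × ℤ).2 ⊆ dyadicInterval p.1 p.2} := by
      filter_upwards [hmem q] with F hF
      obtain ⟨h1, h2⟩ := hg F q hF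
      exact ⟨hL _ ((dyadicLength_rpow_le_dyadicCost h1).trans (hScost F)), h2⟩
    have h2 := (Ultrafilter.eventually_exists_mem_iff (f := 𝒰) hfin
      (P := fun p' F => g F q = p')).1 (h1.mono fun F hF => ⟨_, hF, rfl⟩)
    obtain ⟨p', -, hp'⟩ := h2
    exact ⟨p', hp'⟩
  choose G hG using hlim
  have hcov : (⋃ p ∈ P, dyadicInterval p.1 p.2) ⊆ ⋃ p ∈ range G, dyadicInterval p.1 p.2 := by
    refine iUnion₂_subset fun p hp => ?_
    obtain ⟨F, hF1, hF2⟩ := ((hmem ⟨p, hp⟩).and (hG ⟨p, hp⟩)).exists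
    have := (hg F _ hF1).2
    rw [hF2] at this
    exact this.trans (subset_biUnion_of_mem (u := fun p : ℤ × ℤ => dyadicInterval p.1 p.2)
      (mem_range_self _))
  refine (dyadicContent_le_dyadicCost hcov).trans (dyadicCost_le_of_finset fun H hH => ?_)
  -- Finitely many limit intervals occur together in a single cover `S F`, whose cost is at most
  -- `w`.
  have hev : ∀ᶠ F in (𝒰 : Filter (Finset P)), ∀ p ∈ H, p ∈ S F := by
    rw [Finset.eventually_all]
    intro p hp
    obtain ⟨q, rfl⟩ := hH hp
    filter_upwards [hmem q, hG q] with F hF1 hF2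
    rw [← hF2]; exact (hg F q hF1).1
  obtain ⟨F, hF⟩ := hev.exists
  exact (measure_mono fun p hp => hF p hp).trans (hScost F)

/-! ### Countable intersections of open sets -/

theorem exists_dyadicInterval_subset_closedBall (x : ℝ) {r : ℝ} (hr : 0 < r) (m : ℤ) :
    ∃ n j : ℤ, m ≤ n ∧ x ∈ dyadicInterval n j ∧ closure (dyadicInterval n j) ⊆ Metric.closedBall x r := by
  obtain ⟨k, hk⟩ := exists_pow_lt_of_lt_one hr (show (2⁻¹ : ℝ) < 1 by norm_num)
  set n : ℤ := max m k
  have h1 : (2 : ℝ) ^ (-n) ≤ r := by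
    refine le_trans ?_ hk.le
    rw [inv_pow, ← zpow_natCast, ← zpow_neg]
    exact zpow_le_zpow_right₀ one_le_two (neg_le_neg (le_max_right _ _))
  obtain ⟨j, hj⟩ := exists_mem_dyadicInterval n x
  refine ⟨n, j, le_max_left _ _, hj, closure_minimal (fun y hy => ?_) Metric.isClosed_closedBall⟩
  exact (abs_sub_le_of_mem_dyadicInterval hy hj).trans h1

/-- The dyadic intervals with closure in `U` exhaust `U` inside each member of `F`. Full content of
`U` there lets any cover of them be exchanged for a cover of all of `F` at no extra cost; continuity
from below then gives a finite subfamily. -/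
theorem exists_finset_closure_subset {t : ℝ} (ht0 : 0 < t) (ht1 : t ≤ 1) {U : Set ℝ}
    (hU : IsOpen U) (F : Finset (ℤ × ℤ))
    (hF : ∀ q ∈ F, dyadicLength q.1 ^ t ≤ dyadicContent t (U ∩ dyadicInterval q.1 q.2))
    {v : ℝ≥0∞} (hv : v < dyadicContent t (⋃ q ∈ F, dyadicInterval q.1 q.2)) :
    ∃ F' : Finset (ℤ × ℤ),
      (∀ p ∈ F', ∃ q ∈ F, dyadicInterval p.1 p.2 ⊆ dyadicInterval q.1 q.2) ∧
      closure (⋃ p ∈ F', dyadicInterval p.1 p.2) ⊆ U ∧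
      v < dyadicContent t (⋃ p ∈ F', dyadicInterval p.1 p.2) := by
  set P : Set (ℤ × ℤ) := {p | (∃ q ∈ F, dyadicInterval p.1 p.2 ⊆ dyadicInterval q.1 q.2) ∧
    closure (dyadicInterval p.1 p.2) ⊆ U} with hP
  have hcovP : ∀ q ∈ F, U ∩ dyadicInterval q.1 q.2 ⊆ ⋃ p ∈ P, dyadicInterval p.1 p.2 := by
    rintro q hq x ⟨hxU, hxq⟩
    obtain ⟨r, hr, hball⟩ := Metric.nhds_basis_closedBall.mem_iff.1 (hU.mem_nhds hxU)
    obtain ⟨n, j, hn, hxn, hcl⟩ := exists_dyadicInterval_subset_closedBall x hr q.1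
    exact mem_iUnion₂.2 ⟨(n, j), ⟨⟨q, hq, dyadicInterval_subset_of_mem hn hxq hxn⟩,
      hcl.trans hball⟩, hxn⟩
  have hPv : v < dyadicContent t (⋃ p ∈ P, dyadicInterval p.1 p.2) := by
    refine hv.trans_le (le_dyadicContent fun S hS => ?_)
    obtain ⟨S', hS', -, hFS⟩ := exists_dyadicCost_le_of_finset F hF S
      fun q hq => (hcovP q hq).trans hS
    refine (dyadicContent_le_dyadicCost (iUnion₂_subset fun q hq => ?_)).trans hS'
    obtain ⟨p', hp', hsub⟩ := hFS q hq
    exact hsub.trans (subset_biUnion_of_mem (u := fun p : ℤ × ℤ => dyadicInterval p.1 p.2) hp')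
  have hex : ∃ F' : Finset (ℤ × ℤ), ↑F' ⊆ P ∧
      v < dyadicContent t (⋃ p ∈ F', dyadicInterval p.1 p.2) := by
    by_contra! hcon
    exact hPv.not_ge (dyadicContent_biUnion_le_of_finset ht0 ht1 hcon)
  obtain ⟨F', hF'P, hF'v⟩ := hex
  refine ⟨F', fun p hp => (hF'P hp).1, ?_, hF'v⟩
  rw [Finset.closure_biUnion]
  exact iUnion₂_subset fun p hp => (hF'P hp).2

theorem dyadicCost_image_left_neighbor (t : ℝ) (S : Set (ℤ × ℤ)) :
    dyadicCost t ((fun p : ℤ × ℤ => (p.1, p.2 - 1)) '' S) = dyadicCost t S := by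
  rw [dyadicCost_apply, dyadicCost_apply]
  rw [tsum_image (fun p : ℤ × ℤ => dyadicLength p.1 ^ t)]
  rintro ⟨a, b⟩ _ ⟨c, d⟩ _ h
  simp only [Prod.mk.injEq, sub_left_inj] at h
  exact Prod.ext h.1 h.2

/-- A countable intersection of open sets of full content in all dyadic subintervals of `D` has
large content in the closure of `D`. -/
theorem half_le_dyadicContent_iInter {t : ℝ} (ht0 : 0 < t) (ht1 : t ≤ 1) {U : ℕ → Set ℝ}
    (hU : ∀ m, IsOpen (U m)) {n j : ℤ}
    (hlarge : ∀ m a b, dyadicInterval a b ⊆ dyadicInterval n j →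
      dyadicLength a ^ t ≤ dyadicContent t (U m ∩ dyadicInterval a b)) :
    dyadicLength n ^ t / 2 ≤ dyadicContent t ((⋂ m, U m) ∩ closure (dyadicInterval n j)) := by
  suffices hv : ∀ v < dyadicLength n ^ t, v / 2 ≤
      dyadicContent t ((⋂ m, U m) ∩ closure (dyadicInterval n j)) by
    refine ENNReal.div_le_of_le_mul (le_of_forall_lt fun v hvn => ?_)
    obtain ⟨w, hvw, hwn⟩ := exists_between hvn
    refine hvw.trans_le ?_
    rw [← ENNReal.div_le_iff (by simp) (by simp)]
    exact hv w hwn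
  intro v hvn
  let Good := {F : Finset (ℤ × ℤ) //
    (∀ p ∈ F, dyadicInterval p.1 p.2 ⊆ dyadicInterval n j) ∧
      v < dyadicContent t (⋃ p ∈ F, dyadicInterval p.1 p.2)}
  have hstep : ∀ (m : ℕ) (F : Good), ∃ F' : Good,
      (⋃ p ∈ F'.1, dyadicInterval p.1 p.2) ⊆ (⋃ p ∈ F.1, dyadicInterval p.1 p.2) ∧
      closure (⋃ p ∈ F'.1, dyadicInterval p.1 p.2) ⊆ U m := by
    rintro m ⟨F, hFsub, hFv⟩
    obtain ⟨F', h1, h2, h3⟩ := exists_finset_closure_subset ht0 ht1 (hU m) F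
      (fun q hq => hlarge m _ _ (hFsub q hq)) hFv
    refine ⟨⟨F', fun p hp => ?_, h3⟩, iUnion₂_subset fun p hp => ?_, h2⟩
    · obtain ⟨q, hq, hsub⟩ := h1 p hp
      exact hsub.trans (hFsub q hq)
    · obtain ⟨q, hq, hsub⟩ := h1 p hp
      exact hsub.trans (subset_biUnion_of_mem (u := fun p : ℤ × ℤ => dyadicInterval p.1 p.2) hq)
  choose next hnext_sub hnext_cl using hstep
  let F₀ : Good := ⟨{(n, j)}, by simp, by
    simpa [dyadicContent_dyadicInterval ht0 ht1] using hvn⟩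
  let Fs : ℕ → Good := fun m => Nat.rec F₀ next m
  let A : ℕ → Set ℝ := fun m => ⋃ p ∈ (Fs m).1, dyadicInterval p.1 p.2
  have hA_anti : Antitone A := antitone_nat_of_succ_le fun m => hnext_sub m (Fs m)
  have hA_cl : ∀ m, closure (A (m + 1)) ⊆ U m := fun m => hnext_cl m (Fs m)
  have hA_D : ∀ m, A m ⊆ dyadicInterval n j := fun m => iUnion₂_subset (Fs m).2.1
  have hcompact : ∀ m, IsCompact (closure (A m)) := fun m =>
    ((Metric.isBounded_Ico _ _).subset (hA_D m)).isCompact_closure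
  have hK : (⋂ m, closure (A m)) ⊆ (⋂ m, U m) ∩ closure (dyadicInterval n j) := by
    intro x hx
    rw [mem_iInter] at hx
    exact ⟨mem_iInter.2 fun m => hA_cl m (hx (m + 1)), closure_mono (hA_D 0) (hx 0)⟩
  refine le_dyadicContent fun S hS => ?_
  refine ENNReal.div_le_of_le_mul ?_
  -- Compactness needs open sets, so each half-open interval is enlarged by its left neighbour; this
  -- doubles the cost and is the source of the factor 2.
  set O : Set ℝ := ⋃ p ∈ S, Ioo (((p.2 : ℝ) - 1) * 2 ^ (-p.1)) (((p.2 : ℝ) + 1) * 2 ^ (-p.1))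
    with hO
  have hOopen : IsOpen O := isOpen_biUnion fun p _ => isOpen_Ioo
  have hSO : (⋃ p ∈ S, dyadicInterval p.1 p.2) ⊆ O := by
    refine iUnion₂_mono fun p _ x hx => ⟨?_, hx.2⟩
    have := two_zpow_neg_pos p.1
    exact lt_of_lt_of_le (by nlinarith) hx.1
  obtain ⟨m, hm⟩ := exists_subset_nhds_of_isCompact (V := fun m => closure (A m))
    (Antitone.directed_ge fun a b hab => closure_mono (hA_anti hab)) hcompact
    (U := O) (fun x hx => hOopen.mem_nhds (hSO (hS (hK hx))))
  set S' := (fun p : ℤ × ℤ => (p.1, p.2 - 1)) '' S with hS'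
  have hcov : A m ⊆ ⋃ p ∈ S ∪ S', dyadicInterval p.1 p.2 := by
    intro x hx
    obtain ⟨p, hp, hx1, hx2⟩ := mem_iUnion₂.1 (hm (subset_closure hx))
    by_cases hxp : (p.2 : ℝ) * 2 ^ (-p.1) ≤ x
    · exact mem_iUnion₂.2 ⟨p, Or.inl hp, hxp, hx2⟩
    · refine mem_iUnion₂.2 ⟨(p.1, p.2 - 1), Or.inr ⟨p, hp, rfl⟩, ?_, ?_⟩
      · push_cast; exact hx1.le
      · push_cast; simpa using hxp
  calc v ≤ dyadicContent t (A m) := (Fs m).2.2.le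
    _ ≤ dyadicCost t (S ∪ S') := dyadicContent_le_dyadicCost hcov
    _ ≤ dyadicCost t S + dyadicCost t S' := measure_union_le _ _
    _ = dyadicCost t S * 2 := by rw [hS', dyadicCost_image_left_neighbor, mul_two]

/-! ### Cauchy–Schwarz and Riesz energy -/

theorem sq_lintegral_mul_le {α : Type*} [MeasurableSpace α] (ν : Measure α) {f g : α → ℝ≥0∞}
    (hf : AEMeasurable f ν) (hg : AEMeasurable g ν) :
    (∫⁻ x, f x * g x ∂ν) ^ 2 ≤ (∫⁻ x, f x ^ 2 ∂ν) * ∫⁻ x, g x ^ 2 ∂ν := by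
  have h := ENNReal.lintegral_mul_le_Lp_mul_Lq ν Real.HolderConjugate.two_two hf hg
  have h2 := pow_le_pow_left' h 2
  simp only [Pi.mul_apply, ENNReal.rpow_ofNat] at h2
  refine h2.trans_eq ?_
  rw [mul_pow, ← ENNReal.rpow_natCast, ← ENNReal.rpow_natCast, ← ENNReal.rpow_mul,
    ← ENNReal.rpow_mul]
  norm_num

theorem sq_tsum_le {ι : Type*} {a w : ι → ℝ≥0∞} (hw : ∀ i, w i ≠ 0) (hw' : ∀ i, w i ≠ ∞) :
    (∑' i, a i) ^ 2 ≤ (∑' i, w i) * ∑' i, (w i)⁻¹ * a i ^ 2 := by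
  let _ : MeasurableSpace ι := ⊤
  have h := sq_lintegral_mul_le (Measure.count : Measure ι)
    (f := fun i => w i ^ (1 / 2 : ℝ)) (g := fun i => w i ^ (-(1 / 2) : ℝ) * a i)
    measurable_from_top.aemeasurable measurable_from_top.aemeasurable
  simp only [lintegral_count] at h
  have h1 : ∀ i, w i ^ (1 / 2 : ℝ) * (w i ^ (-(1 / 2) : ℝ) * a i) = a i := by
    intro i
    rw [← mul_assoc, ← ENNReal.rpow_add _ _ (hw i) (hw' i)]; simp
  have h2 : ∀ i, (w i ^ (1 / 2 : ℝ)) ^ 2 = w i := by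
    intro i
    rw [← ENNReal.rpow_natCast, ← ENNReal.rpow_mul]; norm_num
  have h3 : ∀ i, (w i ^ (-(1 / 2) : ℝ) * a i) ^ 2 = (w i)⁻¹ * a i ^ 2 := by
    intro i
    rw [mul_pow, ← ENNReal.rpow_natCast, ← ENNReal.rpow_mul, ← ENNReal.rpow_neg_one]; norm_num
  simpa only [h1, h2, h3] using h

theorem dyadicLength_rpow_neg_le {n j : ℤ} {s : ℝ} (hs : 0 < s) {x y : ℝ}
    (hx : x ∈ dyadicInterval n j) (hy : y ∈ dyadicInterval n j) :
    dyadicLength n ^ (-s) ≤ ENNReal.ofReal |x - y| ^ (-s) := by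
  rw [ENNReal.rpow_neg, ENNReal.rpow_neg, ENNReal.inv_le_inv, ← ofReal_two_zpow_neg]
  gcongr
  exact abs_sub_le_of_mem_dyadicInterval hx hy

/-- The squares `D × D` at one level are disjoint, and the kernel is at least `|D|^(-s)` on each. -/
theorem tsum_sq_measure_dyadicInterval_le {s : ℝ} (hs : 0 < s) (ν : Measure ℝ) (n : ℤ) :
    ∑' j : ℤ, dyadicLength n ^ (-s) * ν (dyadicInterval n j) ^ 2 ≤ rieszEnergy s ν := by
  calc ∑' j : ℤ, dyadicLength n ^ (-s) * ν (dyadicInterval n j) ^ 2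
      ≤ ∑' j : ℤ, ∫⁻ y in dyadicInterval n j, ∫⁻ x, ENNReal.ofReal |x - y| ^ (-s) ∂ν ∂ν := by
        refine ENNReal.tsum_le_tsum fun j => ?_
        calc dyadicLength n ^ (-s) * ν (dyadicInterval n j) ^ 2
            = ∫⁻ y in dyadicInterval n j, ∫⁻ x in dyadicInterval n j,
                dyadicLength n ^ (-s) ∂ν ∂ν := by
              simp only [setLIntegral_const]; ring
          _ ≤ ∫⁻ y in dyadicInterval n j, ∫⁻ x in dyadicInterval n j,
                ENNReal.ofReal |x - y| ^ (-s) ∂ν ∂ν :=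
              setLIntegral_mono' (measurableSet_dyadicInterval n j) fun y hy =>
                setLIntegral_mono' (measurableSet_dyadicInterval n j) fun x hx =>
                  dyadicLength_rpow_neg_le hs hx hy
          _ ≤ _ := lintegral_mono fun y => setLIntegral_le_lintegral _ _
    _ = ∫⁻ y in ⋃ j, dyadicInterval n j, ∫⁻ x, ENNReal.ofReal |x - y| ^ (-s) ∂ν ∂ν :=
        (lintegral_iUnion (measurableSet_dyadicInterval n)
          (pairwise_disjoint_dyadicInterval n) _).symm
    _ ≤ rieszEnergy s ν := setLIntegral_le_lintegral _ _

/-- The indices at level `n + i` of the dyadic subintervals of the interval `(n, j)`. -/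
noncomputable def dyadicChildren (j : ℤ) (i : ℕ) : Finset ℤ := Finset.Ico (j * 2 ^ i) ((j + 1) * 2 ^ i)

theorem mem_dyadicChildren_iff {n j : ℤ} {i : ℕ} {k : ℤ} : k ∈ dyadicChildren j i ↔
    dyadicInterval (n + i) k ⊆ dyadicInterval n j := (dyadicInterval_subset_iff n j i k).symm

theorem sum_measure_dyadicChildren (ν : Measure ℝ) (n j : ℤ) (i : ℕ) :
    ∑ k ∈ dyadicChildren j i, ν (dyadicInterval (n + i) k) = ν (dyadicInterval n j) := by
  rw [← measure_biUnion_finset ((pairwise_disjoint_dyadicInterval _).set_pairwise _)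
    fun k _ => measurableSet_dyadicInterval _ k]
  congr 1
  refine Subset.antisymm (iUnion₂_subset fun k hk => mem_dyadicChildren_iff.1 hk) fun x hx => ?_
  obtain ⟨k, hk⟩ := exists_mem_dyadicInterval (n + i) x
  exact mem_iUnion₂.2 ⟨k, mem_dyadicChildren_iff.2
    (dyadicInterval_subset_of_mem (by simp) hx hk), hk⟩

theorem sum_dyadicChildren_sq_le {s : ℝ} (hs : 0 < s) (ν : Measure ℝ) (n j : ℤ) (i : ℕ) :
    dyadicLength (n + i) ^ (-s) * ∑ k ∈ dyadicChildren j i, ν (dyadicInterval (n + i) k) ^ 2 ≤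
      rieszEnergy s ν := by
  refine le_trans ?_ (tsum_sq_measure_dyadicInterval_le hs ν (n + i))
  rw [Finset.mul_sum]
  exact ENNReal.sum_le_tsum _

/-- Cauchy–Schwarz over the subintervals of length `δ` of a unit interval gives `ν(D)² ≤ energy ·
δ^(s-1)`, which tends to `0`. This reduces the theorem to `s ≤ 1`. -/
theorem measure_eq_zero_of_rieszEnergy_ne_top {s : ℝ} (hs : 1 < s) {ν : Measure ℝ}
    (hν : rieszEnergy s ν ≠ ∞) : ν = 0 := by
  have key : ∀ j, ν (dyadicInterval 0 j) = 0 := by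
    intro j
    have h1 : ∀ i : ℕ, ν (dyadicInterval 0 j) ^ 2 ≤
        rieszEnergy s ν * dyadicLength (0 + i) ^ (s - 1) := by
      intro i
      set d := dyadicLength (0 + i) with hd
      have h0 : d ≠ 0 := dyadicLength_ne_zero _
      have h0' : d ≠ ∞ := dyadicLength_ne_top _
      have h2 := sq_tsum_le (ι := dyadicChildren j i) (w := fun _ => d)
        (a := fun k => ν (dyadicInterval (0 + i) k)) (fun _ => h0) (fun _ => h0')
      rw [Finset.tsum_subtype (dyadicChildren j i) fun k => ν (dyadicInterval (0 + i) k),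
        Finset.tsum_subtype (dyadicChildren j i) fun _ => d,
        Finset.tsum_subtype (dyadicChildren j i) fun k => d⁻¹ * ν (dyadicInterval (0 + i) k) ^ 2,
        sum_measure_dyadicChildren] at h2
      have h3 : ∑ k ∈ dyadicChildren j i, d = 1 := by
        have := sum_measure_dyadicChildren volume 0 j i
        simp only [volume_dyadicInterval] at this
        rw [this]; simp [dyadicLength]
      rw [h3, one_mul, ← Finset.mul_sum] at h2
      refine h2.trans ?_
      have h4 : d⁻¹ = d ^ (-s) * d ^ (s - 1) := by
        rw [← ENNReal.rpow_add _ _ h0 h0', ← ENNReal.rpow_neg_one]; congr 1; ring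
      rw [h4, mul_right_comm]
      gcongr
      exact sum_dyadicChildren_sq_le (by linarith) ν 0 j i
    have hlim : Tendsto (fun i : ℕ => rieszEnergy s ν * dyadicLength (0 + i) ^ (s - 1)) atTop
        (𝓝 0) := by
      simpa using ENNReal.Tendsto.const_mul (tendsto_dyadicLength_add_rpow 0 (sub_pos.2 hs))
        (Or.inr hν)
    have := le_zero_iff.1 (ge_of_tendsto' hlim h1)
    simpa using this
  rw [← Measure.measure_univ_eq_zero]
  have hcov : (univ : Set ℝ) ⊆ ⋃ j, dyadicInterval 0 j := fun x _ =>
    mem_iUnion.2 (exists_mem_dyadicInterval 0 x)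
  exact measure_mono_null hcov (measure_iUnion_null key)

/-! ### Dyadic energy, capacity and weak limits -/

/-- The dyadic `t`-energy of `ν` in the dyadic interval `(n, j)`. -/
noncomputable def dyadicEnergy (t : ℝ) (n j : ℤ) (ν : Measure ℝ) : ℝ≥0∞ :=
  ∑' i : ℕ, dyadicLength (n + i) ^ (-t) *
    ∑ k ∈ dyadicChildren j i, ν (dyadicInterval (n + i) k) ^ 2

theorem tsum_sq_le_dyadicEnergy (t : ℝ) (n j : ℤ) (ν : Measure ℝ) {S : Set (ℤ × ℤ)}
    (hS : ∀ p ∈ S, dyadicInterval p.1 p.2 ⊆ dyadicInterval n j) :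
    ∑' p : S, dyadicLength (p : ℤ × ℤ).1 ^ (-t) *
      ν (dyadicInterval (p : ℤ × ℤ).1 (p : ℤ × ℤ).2) ^ 2 ≤ dyadicEnergy t n j ν := by
  have hlev : ∀ p : S, ∃ x : (Σ i : ℕ, dyadicChildren j i),
      (p : ℤ × ℤ) = (n + x.1, (x.2 : ℤ)) := by
    rintro ⟨⟨m, k⟩, hp⟩
    obtain ⟨i, rfl⟩ := Int.le.dest (level_le_of_dyadicInterval_subset (hS _ hp))
    exact ⟨⟨i, k, mem_dyadicChildren_iff.2 (hS _ hp)⟩, rfl⟩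
  choose e he using hlev
  have hinj : Function.Injective e := fun p q h => Subtype.ext (by rw [he p, he q, h])
  calc _ = ∑' p : S, (fun x : (Σ i : ℕ, dyadicChildren j i) => dyadicLength (n + x.1) ^ (-t) *
        ν (dyadicInterval (n + x.1) x.2) ^ 2) (e p) := by
        refine tsum_congr fun p => ?_
        rw [he p]
    _ ≤ ∑' x : (Σ i : ℕ, dyadicChildren j i), dyadicLength (n + x.1) ^ (-t) *
        ν (dyadicInterval (n + x.1) x.2) ^ 2 := ENNReal.tsum_comp_le_tsum_of_injective hinj _
    _ = _ := by
        rw [ENNReal.tsum_sigma fun i (k : dyadicChildren j i) => dyadicLength (n + i) ^ (-t) *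
          ν (dyadicInterval (n + i) k) ^ 2, dyadicEnergy]
        refine tsum_congr fun i => ?_
        rw [Finset.tsum_subtype (dyadicChildren j i) fun k => dyadicLength (n + i) ^ (-t) *
          ν (dyadicInterval (n + i) k) ^ 2, Finset.mul_sum]

/-- The capacity lower bound for the cost of a cover of a set carrying `ν`. -/
theorem sq_measure_le_dyadicCost_mul {t : ℝ} (ht0 : 0 < t) {ν : Measure ℝ} {A : Set ℝ}
    (hA : ν Aᶜ = 0) {n j : ℤ} {S : Set (ℤ × ℤ)}
    (hS : A ∩ dyadicInterval n j ⊆ ⋃ p ∈ S, dyadicInterval p.1 p.2) :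
    dyadicLength n ^ t ≤ dyadicCost t S ∨
      ν (dyadicInterval n j) ^ 2 ≤ dyadicCost t S * dyadicEnergy t n j ν := by
  by_cases hex : ∃ p ∈ S, dyadicInterval n j ⊆ dyadicInterval p.1 p.2
  · obtain ⟨p, hp, hsub⟩ := hex
    left
    refine le_trans ?_ (dyadicLength_rpow_le_dyadicCost hp)
    gcongr
    exact dyadicLength_le_iff.2 (level_le_of_dyadicInterval_subset hsub)
  push Not at hex
  right
  set R := {p ∈ S | dyadicInterval p.1 p.2 ⊆ dyadicInterval n j} with hR
  have hcov := subset_biUnion_sep hS hex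
  have h1 : ν (dyadicInterval n j) ≤
      ∑' p : R, ν (dyadicInterval (p : ℤ × ℤ).1 (p : ℤ × ℤ).2) := by
    calc ν (dyadicInterval n j) ≤ ν (A ∩ dyadicInterval n j) + ν Aᶜ := by
          refine (measure_mono fun x hx => ?_).trans (measure_union_le _ _)
          by_cases hxA : x ∈ A
          · exact Or.inl ⟨hxA, hx⟩
          · exact Or.inr hxA
      _ ≤ ν (⋃ p : R, dyadicInterval (p : ℤ × ℤ).1 (p : ℤ × ℤ).2) := by
          rw [hA, add_zero, ← biUnion_eq_iUnion R fun p _ => dyadicInterval p.1 p.2]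
          exact measure_mono hcov
      _ ≤ _ := measure_iUnion_le _
  calc ν (dyadicInterval n j) ^ 2
      ≤ (∑' p : R, ν (dyadicInterval (p : ℤ × ℤ).1 (p : ℤ × ℤ).2)) ^ 2 := by gcongr
    -- The weights `|Q|^t` split the sum into a cost factor and an energy factor.
    _ ≤ _ := sq_tsum_le (w := fun p : R => dyadicLength (p : ℤ × ℤ).1 ^ t)
          (fun _ => dyadicLength_rpow_ne_zero _ _) (fun _ => dyadicLength_rpow_ne_top _ _)
    _ ≤ dyadicCost t S * dyadicEnergy t n j ν := by
        rw [← dyadicCost_apply]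
        simp only [← ENNReal.rpow_neg]
        gcongr
        · exact sep_subset _ _
        · exact tsum_sq_le_dyadicEnergy t n j ν fun p hp => hp.2

theorem tsum_dyadicLength_rpow (n : ℤ) (u : ℝ) (hu : 0 < u) :
    ∑' i : ℕ, dyadicLength (n + i) ^ u = dyadicLength n ^ u * (1 - (2 : ℝ≥0∞) ^ (-u))⁻¹ := by
  have h1 : ∀ i : ℕ, dyadicLength (n + i) ^ u =
      dyadicLength n ^ u * ((2 : ℝ≥0∞) ^ (-u)) ^ i := by
    intro i
    rw [dyadicLength_add_nat, ENNReal.mul_rpow_of_nonneg _ _ hu.le, ← ENNReal.rpow_mul,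
      ← ENNReal.rpow_natCast, ← ENNReal.rpow_mul]
    congr 2; ring
  simp_rw [h1]
  rw [ENNReal.tsum_mul_left, ENNReal.tsum_geometric]

theorem geometric_ratio_inv_ne_top {u : ℝ} (hu : 0 < u) : (1 - (2 : ℝ≥0∞) ^ (-u))⁻¹ ≠ ∞ := by
  have h2 : (2 : ℝ≥0∞) ^ (-u) < 1 := ENNReal.rpow_lt_one_of_one_lt_of_neg (by simp) (by linarith)
  exact ENNReal.inv_ne_top.2 (tsub_pos_of_lt h2).ne'

/-- The level with length `δ` contributes at most `δ^(1-t) η(D)`, a geometric series since `t < 1`.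
-/
theorem dyadicEnergy_le_of_sq_le {t : ℝ} (ht1 : t < 1) {n j : ℤ} {ν η : Measure ℝ}
    (h : ∀ m k, dyadicInterval m k ⊆ dyadicInterval n j →
      ν (dyadicInterval m k) ^ 2 ≤ dyadicLength m * η (dyadicInterval m k)) :
    dyadicEnergy t n j ν ≤
      (1 - (2 : ℝ≥0∞) ^ (-(1 - t)))⁻¹ * dyadicLength n ^ (1 - t) * η (dyadicInterval n j) := by
  calc dyadicEnergy t n j ν
      ≤ ∑' i : ℕ, dyadicLength (n + i) ^ (1 - t) * η (dyadicInterval n j) := by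
        refine ENNReal.tsum_le_tsum fun i => ?_
        calc _ ≤ dyadicLength (n + i) ^ (-t) * ∑ k ∈ dyadicChildren j i,
              dyadicLength (n + i) * η (dyadicInterval (n + i) k) := by
              gcongr with k hk
              exact h _ _ (mem_dyadicChildren_iff.1 hk)
          _ = _ := by
              rw [← Finset.mul_sum, sum_measure_dyadicChildren, ← mul_assoc, sub_eq_neg_add,
                ENNReal.rpow_add _ _ (dyadicLength_ne_zero _) (dyadicLength_ne_top _),
                ENNReal.rpow_one]
    _ = _ := by
        rw [ENNReal.tsum_mul_right, tsum_dyadicLength_rpow n (1 - t) (by linarith)]; ring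

/-- Weak convergence with bounded `s`-energy controls the limsup of the dyadic `t`-energies. -/
theorem eventually_dyadicEnergy_le {s t : ℝ} (hts : t < s) (hs : 0 < s) {ν : ℕ → Measure ℝ}
    {μ : Measure ℝ} [IsFiniteMeasure μ] {C : ℝ≥0} (hC : ∀ k, rieszEnergy s (ν k) ≤ C)
    (hlim : ∀ m k, Tendsto (fun l => ν l (dyadicInterval m k)) atTop (𝓝 (μ (dyadicInterval m k))))
    {n j : ℤ} {B : ℝ≥0∞} (hB : dyadicEnergy t n j μ ≤ B) (hB0 : B ≠ 0) (hB' : B ≠ ∞) :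
    ∀ᶠ l in atTop, dyadicEnergy t n j (ν l) ≤ 3 * B := by
  -- Trading `t` for `s` gains `δ^(s-t)` at scale `δ`, so the tail is small uniformly in `l`. The
  -- head is a finite sum, which converges; it ends below `2 * B` and the tail below `B`.
  have htail : Tendsto (fun N : ℕ => C * ∑' i : ℕ, dyadicLength (n + ((i + N : ℕ) : ℤ)) ^ (s - t))
      atTop (𝓝 0) := by
    have h1 := ENNReal.tendsto_sum_nat_add (fun i : ℕ => dyadicLength (n + i) ^ (s - t)) (by
      rw [tsum_dyadicLength_rpow n _ (sub_pos.2 hts)]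
      exact ENNReal.mul_ne_top (dyadicLength_rpow_ne_top _ _)
        (geometric_ratio_inv_ne_top (sub_pos.2 hts)))
    simpa using ENNReal.Tendsto.const_mul h1 (Or.inr ENNReal.coe_ne_top)
  obtain ⟨N, hN⟩ := (htail.eventually_lt_const (pos_iff_ne_zero.2 hB0)).exists
  have hhead : Tendsto (fun l => ∑ i ∈ Finset.range N, dyadicLength (n + i) ^ (-t) *
      ∑ k ∈ dyadicChildren j i, ν l (dyadicInterval (n + i) k) ^ 2) atTop
      (𝓝 (∑ i ∈ Finset.range N, dyadicLength (n + i) ^ (-t) *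
      ∑ k ∈ dyadicChildren j i, μ (dyadicInterval (n + i) k) ^ 2)) := by
    refine tendsto_finsetSum _ fun i _ => ENNReal.Tendsto.const_mul
      (tendsto_finsetSum _ fun k _ => ENNReal.Tendsto.pow (hlim _ _))
      (Or.inr (dyadicLength_rpow_ne_top _ _))
  have hlt : ∑ i ∈ Finset.range N, dyadicLength (n + i) ^ (-t) *
      ∑ k ∈ dyadicChildren j i, μ (dyadicInterval (n + i) k) ^ 2 < 2 * B := by
    refine ((ENNReal.sum_le_tsum _).trans hB).trans_lt ?_
    rw [two_mul]
    exact ENNReal.lt_add_right hB' hB0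
  filter_upwards [hhead.eventually_lt_const hlt] with l hl
  rw [dyadicEnergy, ← ENNReal.summable.sum_add_tsum_nat_add' (k := N)]
  calc _ ≤ 2 * B + C * ∑' i : ℕ, dyadicLength (n + ((i + N : ℕ) : ℤ)) ^ (s - t) := by
        refine add_le_add hl.le ?_
        rw [← ENNReal.tsum_mul_left]
        refine ENNReal.tsum_le_tsum fun i => ?_
        have h1 := (sum_dyadicChildren_sq_le hs (ν l) n j (i + N)).trans (hC l)
        have h2 : dyadicLength (n + ((i + N : ℕ) : ℤ)) ^ (-t) =
            dyadicLength (n + ((i + N : ℕ) : ℤ)) ^ (s - t) *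
            dyadicLength (n + ((i + N : ℕ) : ℤ)) ^ (-s) := by
          rw [← ENNReal.rpow_add _ _ (dyadicLength_ne_zero _) (dyadicLength_ne_top _)]
          congr 1; ring
        rw [h2, mul_assoc, mul_comm (C : ℝ≥0∞)]
        gcongr
    _ ≤ 2 * B + B := by gcongr
    _ = 3 * B := by ring

/-! ### Content of the carriers -/

theorem tendsto_measure_dyadicInterval {μs : ℕ → ProbabilityMeasure ℝ} {μ : ProbabilityMeasure ℝ}
    (hweak : Tendsto μs atTop (𝓝 μ)) (hac : (μ : Measure ℝ) ≪ volume) (n j : ℤ) :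
    Tendsto (fun k => (μs k : Measure ℝ) (dyadicInterval n j)) atTop
      (𝓝 ((μ : Measure ℝ) (dyadicInterval n j))) := by
  refine ProbabilityMeasure.tendsto_measure_of_null_frontier_of_tendsto' hweak (hac ?_)
  have := two_zpow_neg_pos n
  rw [dyadicInterval, frontier_Ico (by nlinarith)]
  exact (Set.toFinite _).measure_zero _

theorem dyadicLength_le_one_of_subset_Icc {n j : ℤ}
    (hD : dyadicInterval n j ⊆ Icc (0 : ℝ) 1) : dyadicLength n ≤ 1 := by
  rw [← volume_dyadicInterval n j]
  exact (measure_mono hD).trans (by simp)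

theorem eLpNorm_two_sq {α : Type*} [MeasurableSpace α] (f : α → ℝ) (ν : Measure α) :
    eLpNorm f 2 ν ^ 2 = ∫⁻ x, ‖f x‖ₑ ^ 2 ∂ν := by
  have h := eLpNorm_nnreal_pow_eq_lintegral (f := f) (μ := ν) (p := 2) (by simp)
  simpa using h

/-- Eventual lower bounds for the content of the carriers, with an arbitrarily small loss in the
exponent that does not depend on the interval. -/
theorem eventually_le_dyadicContent {s t ε : ℝ} (hts : t < s) (ht0 : 0 < t) (ht1 : t < 1)
    (hε : 0 < ε) {E : ℕ → Set ℝ} {μs : ℕ → ProbabilityMeasure ℝ}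
    (hcarried : ∀ k, (μs k : Measure ℝ) (E k)ᶜ = 0) {μ : ProbabilityMeasure ℝ}
    (hweak : Tendsto μs atTop (𝓝 μ)) {h : ℝ → ℝ}
    (hnonneg : ∀ᵐ x ∂(volume.restrict (Icc (0 : ℝ) 1)), 0 ≤ h x)
    (hmeas : AEMeasurable h (volume.restrict (Icc (0 : ℝ) 1)))
    (hdensity : (μ : Measure ℝ) =
      (volume.restrict (Icc (0 : ℝ) 1)).withDensity (fun x => ENNReal.ofReal (h x)))
    (hpos : ∀ n j : ℤ, dyadicInterval n j ⊆ Icc 0 1 → (μ : Measure ℝ) (dyadicInterval n j) ≠ 0)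
    {C : ℝ≥0} (hest : ∀ n j : ℤ, dyadicInterval n j ⊆ Icc 0 1 →
      dyadicLength n ^ (1 + ε) * eLpNorm ((dyadicInterval n j).indicator h) 2 volume ^ 2 ≤
        C * eLpNorm ((dyadicInterval n j).indicator h) 1 volume ^ 2)
    {C' : ℝ≥0} (henergy : ∀ k, rieszEnergy s (μs k : Measure ℝ) ≤ C') :
    ∃ c : ℝ≥0∞, c ≠ 0 ∧ ∀ n j : ℤ, dyadicInterval n j ⊆ Icc 0 1 → ∀ᶠ k in atTop,
      c * dyadicLength n ^ (t + ε) ≤ dyadicContent t (E k ∩ dyadicInterval n j) := by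
  set K : ℝ≥0∞ := (1 - (2 : ℝ≥0∞) ^ (-(1 - t)))⁻¹ with hK
  have hKtop : K ≠ ∞ := geometric_ratio_inv_ne_top (by linarith)
  have hK1 : 1 ≤ K := ENNReal.one_le_inv.2 tsub_le_self
  have hCtop : (C + 1 : ℝ≥0∞) ≠ ∞ := by simp
  -- Here `12 = 3 * 4`: `3` from the energy of `μs k` against its bound, `4` from `μs k (D)² > μ(D)²
  -- / 4`. Using `C + 1` keeps the bound nonzero and `M ≥ 1` even if `C = 0`.
  set M : ℝ≥0∞ := 12 * (K * (C + 1)) with hM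
  have hMtop : M ≠ ∞ := ENNReal.mul_ne_top (by simp) (ENNReal.mul_ne_top hKtop hCtop)
  have hM1 : 1 ≤ M := by
    calc (1 : ℝ≥0∞) = 1 * (1 * 1) := by simp
      _ ≤ M := by
        rw [hM]; gcongr
        · norm_num
        · exact le_add_self
  have hM0 : M ≠ 0 := (zero_lt_one.trans_le hM1).ne'
  set ρ := volume.restrict (Icc (0 : ℝ) 1) with hρ
  have hac : (μ : Measure ℝ) ≪ volume := by
    rw [hdensity]
    exact (withDensity_absolutelyContinuous _ _).trans Measure.absolutelyContinuous_restrict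
  have hμ : ∀ n j, (μ : Measure ℝ) (dyadicInterval n j) =
      ∫⁻ x in dyadicInterval n j, ‖h x‖ₑ ∂ρ := by
    intro n j
    rw [hdensity, withDensity_apply _ (measurableSet_dyadicInterval n j)]
    refine lintegral_congr_ae (ae_restrict_of_ae ?_)
    filter_upwards [hnonneg] with x hx
    rw [Real.enorm_eq_ofReal hx]
  set η := ρ.withDensity fun x => ‖h x‖ₑ ^ 2 with hη
  have hμη : ∀ n j, (μ : Measure ℝ) (dyadicInterval n j) ^ 2 ≤
      dyadicLength n * η (dyadicInterval n j) := by
    intro n j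
    rw [hμ, hη, withDensity_apply _ (measurableSet_dyadicInterval n j)]
    have h1 := sq_lintegral_mul_le (ρ.restrict (dyadicInterval n j)) (f := fun _ => 1)
      (g := fun x => ‖h x‖ₑ) aemeasurable_const hmeas.restrict.enorm
    simp only [one_mul, one_pow, lintegral_const, Measure.restrict_apply_univ] at h1
    refine h1.trans ?_
    gcongr
    exact (Measure.restrict_apply_le _ _).trans_eq (volume_dyadicInterval n j)
  refine ⟨M⁻¹, ENNReal.inv_ne_zero.2 hMtop, fun n j hD => ?_⟩
  have hest' : dyadicLength n ^ (1 + ε) * η (dyadicInterval n j) ≤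
      C * (μ : Measure ℝ) (dyadicInterval n j) ^ 2 := by
    have h1 : ρ.restrict (dyadicInterval n j) = volume.restrict (dyadicInterval n j) := by
      rw [hρ, Measure.restrict_restrict (measurableSet_dyadicInterval n j),
        inter_eq_self_of_subset_left hD]
    have h2 := hest n j hD
    rw [eLpNorm_indicator_eq_eLpNorm_restrict (measurableSet_dyadicInterval n j),
      eLpNorm_indicator_eq_eLpNorm_restrict (measurableSet_dyadicInterval n j),
      eLpNorm_two_sq, eLpNorm_one_eq_lintegral_enorm] at h2
    rwa [hμ, hη, withDensity_apply _ (measurableSet_dyadicInterval n j), h1]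
  set d := dyadicLength n with hd
  have hd0 : d ≠ 0 := dyadicLength_ne_zero n
  have hdtop : d ≠ ∞ := dyadicLength_ne_top n
  set a := (μ : Measure ℝ) (dyadicInterval n j) with ha
  have ha0 : a ^ 2 ≠ 0 := pow_ne_zero 2 (hpos n j hD)
  have hatop : a ^ 2 ≠ ∞ := ENNReal.pow_ne_top (measure_ne_top _ _)
  have hB : dyadicEnergy t n j (μ : Measure ℝ) ≤ K * (C + 1) * d ^ (-(t + ε)) * a ^ 2 := by
    refine (dyadicEnergy_le_of_sq_le ht1 fun m k _ => hμη m k).trans ?_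
    have h1 : d ^ (1 - t) = d ^ (-(t + ε)) * d ^ (1 + ε) := by
      rw [← ENNReal.rpow_add _ _ hd0 hdtop]; congr 1; ring
    calc K * d ^ (1 - t) * η (dyadicInterval n j)
        = K * d ^ (-(t + ε)) * (d ^ (1 + ε) * η (dyadicInterval n j)) := by rw [h1]; ring
      _ ≤ K * d ^ (-(t + ε)) * ((C + 1) * a ^ 2) := by
          refine mul_le_mul_right (hest'.trans ?_) _
          gcongr
          exact le_self_add
      _ = _ := by ring
  have hB0 : K * (C + 1) * d ^ (-(t + ε)) * a ^ 2 ≠ 0 :=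
    mul_ne_zero (mul_ne_zero (mul_ne_zero (zero_lt_one.trans_le hK1).ne' (by simp))
      (dyadicLength_rpow_ne_zero _ _)) ha0
  have hBtop : K * (C + 1) * d ^ (-(t + ε)) * a ^ 2 ≠ ∞ :=
    ENNReal.mul_ne_top (ENNReal.mul_ne_top (ENNReal.mul_ne_top hKtop hCtop)
      (dyadicLength_rpow_ne_top _ _)) hatop
  have hquarter : a ^ 2 / 4 < a ^ 2 :=
    ENNReal.div_lt_of_lt_mul (by
      nth_rewrite 1 [← mul_one (a ^ 2)]
      exact (ENNReal.mul_lt_mul_iff_right ha0 hatop).2 (by norm_num))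
  have hlim := tendsto_measure_dyadicInterval hweak hac
  filter_upwards [eventually_dyadicEnergy_le hts (ht0.trans hts) henergy hlim hB hB0 hBtop,
    ((ENNReal.Tendsto.pow (n := 2) (hlim n j)).eventually_const_lt hquarter)] with k hk1 hk2
  refine le_dyadicContent fun S hS => ?_
  rw [mul_comm, ← div_eq_mul_inv, ENNReal.div_le_iff hM0 hMtop]
  rcases sq_measure_le_dyadicCost_mul ht0 (hcarried k) hS with h1 | h1
  -- One member of the cover may contain `D`; then `|D| ≤ 1` absorbs the extra `ε`.
  · calc d ^ (t + ε) ≤ d ^ t := ENNReal.rpow_le_rpow_of_exponent_ge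
          (dyadicLength_le_one_of_subset_Icc hD) (by linarith)
      _ ≤ dyadicCost t S * 1 := by rwa [mul_one]
      _ ≤ dyadicCost t S * M := by gcongr
  · have h2 : a ^ 2 * 1 ≤ a ^ 2 * (d ^ (-(t + ε)) * (dyadicCost t S * M)) := by
      calc a ^ 2 * 1 = a ^ 2 / 4 * 4 := by
            rw [ENNReal.div_mul_cancel (by simp) (by simp), mul_one]
        _ ≤ dyadicCost t S * (3 * (K * (C + 1) * d ^ (-(t + ε)) * a ^ 2)) * 4 := by
            gcongr
            exact hk2.le.trans (h1.trans (by gcongr))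
        _ = _ := by rw [hM]; ring
    have h3 := (ENNReal.mul_le_mul_iff_right ha0 hatop).1 h2
    calc d ^ (t + ε) = d ^ (t + ε) * 1 := (mul_one _).symm
      _ ≤ d ^ (t + ε) * (d ^ (-(t + ε)) * (dyadicCost t S * M)) := by gcongr
      _ = dyadicCost t S * M := by
        rw [← mul_assoc, ← ENNReal.rpow_add _ _ hd0 hdtop, add_neg_cancel, ENNReal.rpow_zero,
          one_mul]

/-! ### Assembling the theorem -/

/-- The intersection lemma works in a closure, while the class uses half-open intervals; passing to
the left half bridges the gap. -/
theorem closure_left_half_subset (n j : ℤ) :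
    closure (dyadicInterval (n + 1) (2 * j)) ⊆ dyadicInterval n j := by
  have h2 := two_zpow_neg_pos (n + 1)
  have h3 : (2 : ℝ) ^ (-n) = 2 * 2 ^ (-(n + 1)) := by simpa using two_zpow_neg_add_nat n 1
  rw [dyadicInterval, closure_Ico (by nlinarith), dyadicInterval, h3]
  push_cast
  intro x hx
  exact ⟨by linarith [hx.1], by nlinarith [hx.2]⟩

theorem limsup_eq_iInter_inter {E V : ℕ → Set ℝ} {I : Set ℝ} (hE : ∀ k, E k = V k ∩ I) :
    limsup E atTop = (⋂ m, ⋃ k ≥ m, V k) ∩ I := by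
  ext x
  rw [mem_limsup_iff_frequently_mem, frequently_atTop]
  simp only [hE, mem_inter_iff, mem_iInter, mem_iUnion, exists_prop]
  refine ⟨fun hx => ⟨fun m => ?_, ?_⟩, fun hx m => ?_⟩
  · obtain ⟨k, hk, hkV, -⟩ := hx m
    exact ⟨k, hk, hkV⟩
  · obtain ⟨k, -, -, hkI⟩ := hx 0
    exact hkI
  · obtain ⟨k, hk, hkV⟩ := hx.1 m
    exact ⟨k, hk, hkV, hx.2⟩

theorem theorem1 (s : ℝ) (hs : 0 < s)
    (E : ℕ → Set ℝ)
    -- each `E k` is a (relatively) open subset of `[0,1]`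
    (hE : ∀ k, ∃ U : Set ℝ, IsOpen U ∧ E k = U ∩ Icc 0 1)
    (μs : ℕ → ProbabilityMeasure ℝ)
    -- `μs k` is carried by `E k`
    (hcarried : ∀ k, (μs k : Measure ℝ) (E k)ᶜ = 0)
    (μ : ProbabilityMeasure ℝ)
    -- weak convergence
    (hweak : Tendsto μs atTop (𝓝 μ))
    -- `μ` has a density `h` in `L²([0,1])`
    (h : ℝ → ℝ)
    (hnonneg : ∀ᵐ x ∂(volume.restrict (Icc (0 : ℝ) 1)), 0 ≤ h x)
    (hL2 : MemLp h 2 (volume.restrict (Icc (0 : ℝ) 1)))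
    (hdensity : (μ : Measure ℝ) =
      (volume.restrict (Icc (0 : ℝ) 1)).withDensity (fun x => ENNReal.ofReal (h x)))
    -- `μ(I) > 0` for all intervals `I ⊆ [0,1]` with non-empty interior
    (hpos : ∀ I : Set ℝ, I.OrdConnected → I ⊆ Icc 0 1 → (interior I).Nonempty →
      0 < (μ : Measure ℝ) I)
    (hest : ∀ ε : ℝ, 0 < ε → ∃ C : ℝ≥0, ∀ I : Set ℝ, I.OrdConnected → I ⊆ Icc 0 1 →
      (volume I) ^ (1 + ε) * eLpNorm (I.indicator h) 2 volume ^ 2 ≤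
        C * eLpNorm (I.indicator h) 1 volume ^ 2)
    (henergy : ∃ C : ℝ≥0, ∀ k, rieszEnergy s (μs k : Measure ℝ) ≤ C) :
    limsup E atTop ∈ LargeIntersectionClass s := by
  choose V hV hEV using hE
  obtain ⟨C', hC'⟩ := henergy
  have hs1 : s ≤ 1 := by
    by_contra! hlt
    have h0 := measure_eq_zero_of_rieszEnergy_ne_top hlt
      ((hC' 0).trans_lt ENNReal.coe_lt_top).ne
    exact IsProbabilityMeasure.ne_zero _ h0
  have hUopen : ∀ m, IsOpen (⋃ k ≥ m, V k) := fun m => isOpen_biUnion fun k _ => hV k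
  have hlimsup := limsup_eq_iInter_inter hEV
  refine ⟨hlimsup ▸ inter_subset_right, ?_, fun t ht0 hts => ?_⟩
  · rw [hlimsup]
    exact (IsGδ.iInter fun m => (hUopen m).isGδ).inter isClosed_Icc.isGδ
  have ht1 : t < 1 := hts.trans_le hs1
  -- This `ε` keeps `t + ε < 1`, as the improvement of the exponent requires.
  have hε : 0 < (1 - t) / 2 := by linarith
  have hdyadic : ∀ n j : ℤ, (dyadicInterval n j).OrdConnected := fun n j => ordConnected_Ico
  obtain ⟨C, hC⟩ := hest _ hε
  obtain ⟨c, hc0, hc⟩ := eventually_le_dyadicContent hts ht0 ht1 hε hcarried hweak hnonneg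
    hL2.aestronglyMeasurable.aemeasurable hdensity
    (fun n j hD => (hpos _ (hdyadic n j) hD (by
      have := two_zpow_neg_pos n
      rw [dyadicInterval, interior_Ico]
      exact nonempty_Ioo.2 (by nlinarith))).ne')
    (fun n j hD => volume_dyadicInterval n j ▸ hC _ (hdyadic n j) hD) hC'
  have hfull : ∀ m n j, dyadicInterval n j ⊆ Icc 0 1 →
      dyadicLength n ^ t ≤ dyadicContent t ((⋃ k ≥ m, V k) ∩ dyadicInterval n j) := by
    intro m n j hD
    refine dyadicLength_rpow_le_dyadicContent_inter ht0 ht1.le (u := t + (1 - t) / 2)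
      (by linarith) hc0 fun a b hab => ?_
    -- The index `k` depends on the interval; the union over all `k ≥ m` absorbs this.
    obtain ⟨k, hk, hmk⟩ := ((hc a b (hab.trans hD)).and (eventually_ge_atTop m)).exists
    refine hk.trans (dyadicContent_mono (inter_subset_inter_left _ ?_))
    rw [hEV]
    exact inter_subset_left.trans (subset_biUnion_of_mem (u := V) hmk)
  -- The factor `2 ^ (-t)` pays for the left half, the `1 / 2` for the compactness argument.
  refine ⟨2 ^ (-t) / 2, by positivity, fun n j hD => ?_⟩
  have hhalf := closure_left_half_subset n j
  calc ((2 ^ (-t) / 2 : ℝ≥0) : ℝ≥0∞) * dyadicContent t (dyadicInterval n j)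
      ≤ ((2 ^ (-t) / 2 : ℝ≥0) : ℝ≥0∞) * dyadicLength n ^ t := by
        gcongr; exact dyadicContent_dyadicInterval_le t n j
    _ = dyadicLength (n + 1) ^ t / 2 := by
        have h1 : dyadicLength (n + 1) = dyadicLength n * (2 : ℝ≥0∞) ^ (-1 : ℝ) := by
          simpa using dyadicLength_add_nat n 1
        rw [h1, ENNReal.mul_rpow_of_nonneg _ _ ht0.le, ← ENNReal.rpow_mul, neg_one_mul,
          ENNReal.coe_div two_ne_zero, ENNReal.coe_rpow_of_ne_zero two_ne_zero]
        simp only [ENNReal.coe_ofNat, div_eq_mul_inv]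
        ring
    _ ≤ dyadicContent t ((⋂ m, ⋃ k ≥ m, V k) ∩ closure (dyadicInterval (n + 1) (2 * j))) :=
        half_le_dyadicContent_iInter ht0 ht1.le hUopen fun m a b hab =>
          hfull m a b (hab.trans (subset_closure.trans (hhalf.trans hD)))
    _ ≤ dyadicContent t (limsup E atTop ∩ dyadicInterval n j) := by
        refine dyadicContent_mono fun x hx => ?_
        rw [hlimsup]
        exact ⟨⟨hx.1, hD (hhalf hx.2)⟩, hhalf hx.2⟩
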